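/- Let $A:\mathbb T^2\to\mathbb T^2$ be a linear Anosov diffeomorphism of the torus $\mathbb T^2=\mathbb R^2/\mathbb Z^2$ with its flat metric $d$, i.e. the automorphism induced by a matrix in $GL(2,\mathbb Z)$ without eigenvalues of modulus $1$. There exist sequences of periodic points of $A$ lying in pairwise different orbits; let $(p_k)_{k\ge 1}$ be any such sequence and let $\pi(p_k)$ be the prime period of $p_k$. Let $X=\mathbb T^2\cup E$, where $E=\{q(k,j): k\ge 1,\ 0\le j<\pi(p_k)\}$ consists of pairwise different points not in $\mathbb T^2$, with the symmetric distance $D$ that satisfies $D(x,x)=0$ and $$D(x,y)=\begin{cases} d(x,y), & x,y\in\mathbb T^2,\\ \frac1k+d(y,A^j(p_k)), & x=q(k,j),\ y\in\mathbb T^2,\\ \frac1k+\frac1m+d(A^j(p_k),A^r(p_m)), & x=q(k,j),\ y=q(m,r),\ (k,j)\ne(m,r),\end{cases}$$ and let $f:X\to X$ be given by $f=A$ on $\mathbb T^2$ and $f(q(k,j))=q(k,(j+1)\bmod \pi(p_k))$. For a homeomorphism $f$ of a compact metric space $(X,D)$, $x\in X$ and $\delta>0$ put $\Gamma_\delta(x)=\{y\in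 X: D(f^i(x),f^i(y))\le\delta \text{ for all } i\in\mathbb Z\}$. The map $f$ is $N$-expansive if for some $\delta>0$ every $\Gamma_\delta(x)$ has at most $N$ elements; measure expansive if for some $\delta>0$ one has $\mu(\Gamma_\delta(x))=0$ for every $x\in X$ and every $f$-invariant non-atomic Borel probability measure $\mu$; and strongly measure expansive if for some $\delta>0$ one has $\mu(\Gamma_\delta(x))=\mu(\{x\})$ for every $x\in X$ and every $f$-invariant Borel probability measure $\mu$. Then: 1. $(X,D)$ is a compact metric space that contains $(\mathbb T^2,d)$ isometrically, and $f$ is a homeomorphism of $X$ extending $A$. 2. The set $E$ is countably infinite, its points are isolated in $X$, and for each $k$ the set $\{q(k,j): 0\le j<\pi(p_k)\}$ is a single periodic orbit of $f$, of prime period $\pi(p_k)$. These orbits accumulate on periodic orbits of $A$: for every $\delta>0$ and all sufficiently large $k$, $q(k,j)\in\Gamma_\delta(A^j(p_k))$ for all $0\le j<\pi(p_k)$. 3. $f$ is $2$-expansive and measure expansive, but not strongly measure expansive. Consequently, for every $N\ge 2$ there is a homeomorphism of a compact metric space that is $N$-expansive and measure expansive but not strongly measure expansive. -/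

import Mathlib

open Set Function Filter Topology MeasureTheory

noncomputable section

section Expansiveness

variable {X : Type*} [MetricSpace X]

/-- The local stable set `W^s_ε(x, f)`. -/
def localStableSet (f : X ≃ₜ X) (ε : ℝ) (x : X) : Set X :=
  {y | ∀ i : ℕ, dist (f^[i] x) (f^[i] y) ≤ ε}

/-- The local unstable set `W^u_ε(x, f)`. -/
def localUnstableSet (f : X ≃ₜ X) (ε : ℝ) (x : X) : Set X :=
  {y | ∀ i : ℕ, dist (f.symm^[i] x) (f.symm^[i] y) ≤ ε}

/-- `Γ_δ(x, f) = W^s_δ(x, f) ∩ W^u_δ(x, f)`. -/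
def dynBall (f : X ≃ₜ X) (δ : ℝ) (x : X) : Set X :=
  localStableSet f δ x ∩ localUnstableSet f δ x

/-- `f` is `n`-expansive: for some `δ > 0` every `Γ_δ(x)` has at most `n` elements. -/
def NExpansive (n : ℕ) (f : X ≃ₜ X) : Prop :=
  ∃ δ : ℝ, 0 < δ ∧ ∀ x : X, (dynBall f δ x).encard ≤ n

/-- `f` is measure expansive: for some `δ > 0`, every `Γ_δ(x)` is null for every `f`-invariant
non-atomic Borel probability measure. -/
def MeasureExpansive [MeasurableSpace X] [BorelSpace X] (f : X ≃ₜ X) : Prop :=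
  ∃ δ : ℝ, 0 < δ ∧ ∀ μ : Measure X, IsProbabilityMeasure μ → MeasurePreserving f μ μ →
    (∀ x : X, μ {x} = 0) → ∀ x : X, μ (dynBall f δ x) = 0

/-- `f` is strongly measure expansive: for some `δ > 0`, `μ (Γ_δ(x)) = μ {x}` for every
`f`-invariant Borel probability measure `μ` and every point `x`. -/
def StronglyMeasureExpansive [MeasurableSpace X] [BorelSpace X] (f : X ≃ₜ X) : Prop :=
  ∃ δ : ℝ, 0 < δ ∧ ∀ μ : Measure X, IsProbabilityMeasure μ → MeasurePreserving f μ μ →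
    ∀ x : X, μ (dynBall f δ x) = μ {x}

end Expansiveness

section Extension

variable {Y : Type*}

/-- The set `Y ∪ E`, where `E` consists of pairwise different new points `q(k, j)`, written
`extra k j`, for `k : ℕ` and `0 ≤ j < π(p k)`, with `π(p k)` the prime period of `p k`
under `A`. -/
inductive PeriodicExtension (A : Y → Y) (p : ℕ → Y) : Type _
  | base (y : Y) : PeriodicExtension A p
  | extra (k : ℕ) (j : Fin (minimalPeriod A (p k))) : PeriodicExtension A p

namespace PeriodicExtension

/-- The distance on `Y ∪ E`. The sequence is indexed from `0`, so that the weight of the `k`-th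
orbit is `1 / (k + 1)`. -/
def extDist [MetricSpace Y] {A : Y → Y} {p : ℕ → Y} :
    PeriodicExtension A p → PeriodicExtension A p → ℝ
  | base x, base y => dist x y
  | extra k j, base y => 1 / ((k : ℝ) + 1) + dist y (A^[(j : ℕ)] (p k))
  | base y, extra k j => 1 / ((k : ℝ) + 1) + dist y (A^[(j : ℕ)] (p k))
  | extra k j, extra m r =>
      if k = m ∧ (j : ℕ) = (r : ℕ) then 0
      else 1 / ((k : ℝ) + 1) + 1 / ((m : ℝ) + 1)
        + dist (A^[(j : ℕ)] (p k)) (A^[(r : ℕ)] (p m))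

theorem extra_eq {A : Y → Y} {p : ℕ → Y} {k m : ℕ} {j : Fin (minimalPeriod A (p k))}
    {r : Fin (minimalPeriod A (p m))} (h : k = m ∧ (j : ℕ) = (r : ℕ)) :
    (extra k j : PeriodicExtension A p) = extra m r := by
  obtain ⟨rfl, h⟩ := h
  rw [Fin.ext h]

instance instMetricSpace [MetricSpace Y] (A : Y → Y) (p : ℕ → Y) :
    MetricSpace (PeriodicExtension A p) where
  dist := extDist
  dist_self x := by
    cases x <;> simp [extDist]
  dist_comm x y := by
    cases x with
    | base x =>
      cases y with
      | base y => exact dist_comm x y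
      | extra m r => rfl
    | extra k j =>
      cases y with
      | base y => rfl
      | extra m r =>
        simp only [extDist]
        rw [dist_comm (A^[(j : ℕ)] (p k)), add_comm (1 / ((k : ℝ) + 1))]
        simp only [eq_comm]
  dist_triangle x y z := by
    have hpos : ∀ k : ℕ, 0 < 1 / ((k : ℝ) + 1) := fun k => by positivity
    cases x with
    | base x =>
      cases y with
      | base y =>
        cases z with
        | base z => exact dist_triangle x y z
        | extra n s =>
          simp only [extDist]
          linarith [dist_triangle x y (A^[(s : ℕ)] (p n))]
      | extra m r =>
        cases z with
        | base z =>
          simp only [extDist]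
          linarith [dist_triangle x (A^[(r : ℕ)] (p m)) z, hpos m,
            dist_comm z (A^[(r : ℕ)] (p m))]
        | extra n s =>
          by_cases h : m = n ∧ (r : ℕ) = (s : ℕ)
          · rw [extra_eq h]
            simp [extDist]
          · simp only [extDist, if_neg h]
            linarith [dist_triangle x (A^[(r : ℕ)] (p m)) (A^[(s : ℕ)] (p n)), hpos m]
    | extra k j =>
      cases y with
      | base y =>
        cases z with
        | base z =>
          simp only [extDist]
          linarith [dist_triangle z y (A^[(j : ℕ)] (p k)), dist_comm y z]
        | extra n s =>
          by_cases h : k = n ∧ (j : ℕ) = (s : ℕ)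
          · rw [extra_eq h]
            simp only [extDist, and_self, if_true]
            linarith [hpos n, dist_nonneg (x := y) (y := A^[(s : ℕ)] (p n))]
          · simp only [extDist, if_neg h]
            linarith [dist_triangle (A^[(j : ℕ)] (p k)) y (A^[(s : ℕ)] (p n)),
              dist_comm y (A^[(j : ℕ)] (p k))]
      | extra m r =>
        by_cases h : k = m ∧ (j : ℕ) = (r : ℕ)
        · rw [extra_eq h]
          cases z <;> simp [extDist]
        · cases z with
          | base z =>
            simp only [extDist, if_neg h]
            linarith [dist_triangle z (A^[(r : ℕ)] (p m)) (A^[(j : ℕ)] (p k)), hpos m,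
              dist_comm (A^[(r : ℕ)] (p m)) (A^[(j : ℕ)] (p k))]
          | extra n s =>
            by_cases h' : m = n ∧ (r : ℕ) = (s : ℕ)
            · rw [extra_eq h']
              simp [extDist]
            · by_cases h'' : k = n ∧ (j : ℕ) = (s : ℕ)
              · simp only [extDist, if_neg h, if_neg h', if_pos h'']
                linarith [hpos k, hpos m, hpos n,
                  dist_nonneg (x := A^[(j : ℕ)] (p k)) (y := A^[(r : ℕ)] (p m)),
                  dist_nonneg (x := A^[(r : ℕ)] (p m)) (y := A^[(s : ℕ)] (p n))]
              · simp only [extDist, if_neg h, if_neg h', if_neg h'']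
                linarith [hpos m, dist_triangle (A^[(j : ℕ)] (p k)) (A^[(r : ℕ)] (p m))
                  (A^[(s : ℕ)] (p n))]
  eq_of_dist_eq_zero := by
    intro x y hxy
    have hpos : ∀ k : ℕ, 0 < 1 / ((k : ℝ) + 1) := fun k => by positivity
    change extDist x y = 0 at hxy
    cases x with
    | base x =>
      cases y with
      | base y => rw [eq_of_dist_eq_zero hxy]
      | extra m r =>
        simp only [extDist] at hxy
        linarith [hpos m, dist_nonneg (x := x) (y := A^[(r : ℕ)] (p m))]
    | extra k j =>
      cases y with
      | base y =>
        simp only [extDist] at hxy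
        linarith [hpos k, dist_nonneg (x := y) (y := A^[(j : ℕ)] (p k))]
      | extra m r =>
        by_cases h : k = m ∧ (j : ℕ) = (r : ℕ)
        · exact extra_eq h
        · simp only [extDist, if_neg h] at hxy
          linarith [hpos k, hpos m,
            dist_nonneg (x := A^[(j : ℕ)] (p k)) (y := A^[(r : ℕ)] (p m))]

instance instMeasurableSpace [MetricSpace Y] (A : Y → Y) (p : ℕ → Y) :
    MeasurableSpace (PeriodicExtension A p) := borel _

instance instBorelSpace [MetricSpace Y] (A : Y → Y) (p : ℕ → Y) :
    BorelSpace (PeriodicExtension A p) := ⟨rfl⟩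

/-- `A` on `Y`, and `q(k, j) ↦ q(k, (j + 1) mod π(p k))` on the new points. -/
def extFun (A : Y → Y) (p : ℕ → Y) : PeriodicExtension A p → PeriodicExtension A p
  | base y => base (A y)
  | extra k j =>
      extra k ⟨((j : ℕ) + 1) % minimalPeriod A (p k), Nat.mod_lt _ (j.val.zero_le.trans_lt j.2)⟩

/-- The inverse of `extFun` if `B` is the inverse of `A`. -/
def extInv (A B : Y → Y) (p : ℕ → Y) : PeriodicExtension A p → PeriodicExtension A p
  | base y => base (B y)
  | extra k j =>
      extra k ⟨((j : ℕ) + (minimalPeriod A (p k) - 1)) % minimalPeriod A (p k),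
        Nat.mod_lt _ (j.val.zero_le.trans_lt j.2)⟩

/-- A criterion for continuity of maps of the extension. -/
theorem continuous_aux [MetricSpace Y] {A : Y → Y} {p : ℕ → Y} (C : Y → Y) (hC : Continuous C)
    (F : PeriodicExtension A p → PeriodicExtension A p) (hb : ∀ y, F (base y) = base (C y))
    (he : ∀ k j, ∃ r, F (extra k j) = extra k r ∧ A^[(r : ℕ)] (p k) = C (A^[(j : ℕ)] (p k))) :
    Continuous F := by
  have hpos : ∀ k : ℕ, 0 < 1 / ((k : ℝ) + 1) := fun k => by positivity
  rw [Metric.continuous_iff]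
  intro x ε hε
  cases x with
  | base x =>
    obtain ⟨δ, hδ, h⟩ := Metric.continuous_iff.1 hC x (ε / 2) (by linarith)
    refine ⟨min δ (ε / 2), lt_min hδ (by linarith), fun y hy => ?_⟩
    have hy1 := hy.trans_le (min_le_left _ _)
    have hy2 := hy.trans_le (min_le_right _ _)
    cases y with
    | base y =>
      rw [hb, hb]
      change dist (C y) (C x) < ε
      linarith [h y hy1]
    | extra k j =>
      obtain ⟨r, h1, h2⟩ := he k j
      rw [hb, h1]
      change 1 / ((k : ℝ) + 1) + dist (C x) (A^[(r : ℕ)] (p k)) < ε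
      change 1 / ((k : ℝ) + 1) + dist x (A^[(j : ℕ)] (p k)) < δ at hy1
      change 1 / ((k : ℝ) + 1) + dist x (A^[(j : ℕ)] (p k)) < ε / 2 at hy2
      rw [h2, dist_comm]
      have := h (A^[(j : ℕ)] (p k)) (by rw [dist_comm]; linarith [hpos k])
      linarith [dist_nonneg (x := x) (y := A^[(j : ℕ)] (p k))]
  | extra k j =>
    refine ⟨1 / ((k : ℝ) + 1), hpos k, fun y hy => ?_⟩
    cases y with
    | base y =>
      change 1 / ((k : ℝ) + 1) + dist y (A^[(j : ℕ)] (p k)) < _ at hy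
      linarith [dist_nonneg (x := y) (y := A^[(j : ℕ)] (p k))]
    | extra m r =>
      by_cases h : m = k ∧ (r : ℕ) = (j : ℕ)
      · rw [extra_eq h, dist_self]
        exact hε
      · change extDist _ _ < _ at hy
        simp only [extDist, if_neg h] at hy
        linarith [hpos m, dist_nonneg (x := A^[(r : ℕ)] (p m)) (y := A^[(j : ℕ)] (p k))]

/-- The homeomorphism `f` of `Y ∪ E`. -/
def extHomeo [MetricSpace Y] (A : Y ≃ₜ Y) (p : ℕ → Y) :
    PeriodicExtension A p ≃ₜ PeriodicExtension A p where
  toFun := extFun A p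
  invFun := extInv A A.symm p
  left_inv x := by
    cases x with
    | base y => simp [extFun, extInv]
    | extra k j =>
      have hj := j.2
      apply extra_eq ⟨rfl, _⟩
      simp only [Nat.mod_add_mod]
      rw [show (j : ℕ) + 1 + (minimalPeriod A (p k) - 1) = j + minimalPeriod A (p k) by omega,
        Nat.add_mod_right, Nat.mod_eq_of_lt hj]
  right_inv x := by
    cases x with
    | base y => simp [extFun, extInv]
    | extra k j =>
      have hj := j.2
      apply extra_eq ⟨rfl, _⟩
      simp only [Nat.mod_add_mod]
      rw [show (j : ℕ) + (minimalPeriod A (p k) - 1) + 1 = j + minimalPeriod A (p k) by omega,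
        Nat.add_mod_right, Nat.mod_eq_of_lt hj]
  continuous_toFun := by
    refine continuous_aux A A.continuous _ (fun y => rfl) (fun k j => ⟨_, rfl, ?_⟩)
    simp only [iterate_mod_minimalPeriod_eq, iterate_succ_apply']
  continuous_invFun := by
    refine continuous_aux A.symm A.symm.continuous _ (fun y => rfl) (fun k j => ⟨_, rfl, ?_⟩)
    have hj := j.2
    apply A.injective
    simp only [iterate_mod_minimalPeriod_eq, Homeomorph.apply_symm_apply]
    rw [← iterate_succ_apply' (f := A),
      show ((j : ℕ) + (minimalPeriod A (p k) - 1)).succ = j + minimalPeriod A (p k) by omega,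
      iterate_add_minimalPeriod_eq]

end PeriodicExtension

end Extension

section Torus

/-- The torus `ℝ² / ℤ² = (ℝ / ℤ)²` with its flat Euclidean metric. -/
abbrev FlatTorus : Type := PiLp 2 (fun _ : Fin 2 => UnitAddCircle)

/-- The map of the torus induced by an integer matrix. -/
def toralMap (M : Matrix (Fin 2) (Fin 2) ℤ) (x : FlatTorus) : FlatTorus :=
  WithLp.toLp 2 fun i => ∑ j, M i j • x j

theorem continuous_toralMap (M : Matrix (Fin 2) (Fin 2) ℤ) : Continuous (toralMap M) := by
  unfold toralMap
  fun_prop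

theorem toralMap_mul (M N : Matrix (Fin 2) (Fin 2) ℤ) (x : FlatTorus) :
    toralMap M (toralMap N x) = toralMap (M * N) x := by
  ext i
  simp [toralMap, Matrix.mul_apply, Fin.sum_univ_two, add_smul, mul_smul]
  abel

theorem toralMap_one (x : FlatTorus) : toralMap 1 x = x := by
  ext i
  fin_cases i <;> simp [toralMap, Fin.sum_univ_two]

/-- The linear automorphism of the torus induced by a matrix in `GL(2, ℤ)`. -/
def toralAut (M : GL (Fin 2) ℤ) : FlatTorus ≃ₜ FlatTorus where
  toFun := toralMap M.val
  invFun := toralMap M.inv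
  left_inv x := by rw [toralMap_mul, M.inv_val, toralMap_one]
  right_inv x := by rw [toralMap_mul, M.val_inv, toralMap_one]
  continuous_toFun := continuous_toralMap _
  continuous_invFun := continuous_toralMap _

/-- `M` has no complex eigenvalue of modulus `1`, that is, the linear automorphism of the torus
induced by `M` is Anosov. -/
def IsHyperbolicMatrix (M : GL (Fin 2) ℤ) : Prop :=
  ∀ z ∈ spectrum ℂ (M.val.map (fun a : ℤ => (a : ℂ))), ‖z‖ ≠ 1

/-- `p` is a sequence of periodic points of `A` that lie in pairwise different orbits. -/
def PeriodicInDistinctOrbits {Y : Type*} (A : Y → Y) (p : ℕ → Y) : Prop :=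
  (∀ k, p k ∈ periodicPts A) ∧ ∀ k m, k ≠ m → ∀ i : ℕ, A^[i] (p k) ≠ p m

end Torus

end

/-! Forgetting the extra points, `q(k, j) ↦ A^j (p k)`, is a 1-Lipschitz semiconjugacy `proj` from
`f` to `A`. Hence it maps `Γ_δ(x)` into `Γ_δ(proj x)`, which is a single point because `A` is
expansive. So `Γ_δ(x)` lies in one fibre of `proj`, and since the `p k` lie in different orbits a
fibre has at most two points. This is 2-expansiveness; finite sets are null for non-atomic measures,
so measure expansiveness follows. Strong measure expansiveness fails because, once `1 / (k + 1) ≤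
δ`, `q(k, 0)` lies in `Γ_δ(p k)`: the uniform measure on the orbit of `q(k, 0)` charges this set but
not the point `p k`.

Expansiveness of `A` reduces by linearity to small orbits of differences. These lift to bounded
orbits of the matrix in the plane, which vanish because no eigenvalue has modulus `1`. Torsion
points of different orders supply the sequences `p`. -/

theorem NExpansive.mono {X : Type*} [MetricSpace X] {f : X ≃ₜ X} {m n : ℕ} (hmn : m ≤ n)
    (h : NExpansive m f) : NExpansive n f := by
  obtain ⟨δ, hδ, h⟩ := h
  exact ⟨δ, hδ, fun x => (h x).trans (by exact_mod_cast hmn)⟩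

/-- An `n`-expansive homeomorphism is measure expansive. -/
theorem NExpansive.measureExpansive {X : Type*} [MetricSpace X] [MeasurableSpace X] [BorelSpace X]
    {f : X ≃ₜ X} {n : ℕ} (h : NExpansive n f) : MeasureExpansive f := by
  obtain ⟨δ, hδ, h⟩ := h
  refine ⟨δ, hδ, fun μ _ _ hμ x => ?_⟩
  have hfin : (dynBall f δ x).Finite := Set.finite_of_encard_le_coe (h x)
  rw [← biUnion_of_singleton (dynBall f δ x), measure_biUnion_null_iff hfin.countable]
  exact fun y _ => hμ y

/-- The uniform distribution on a periodic orbit. -/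
theorem exists_invariant_measure_of_mem_periodicPts {X : Type*} [MeasurableSpace X]
    [MeasurableSingletonClass X] {f : X → X} (hf : Measurable f) {x : X}
    (hx : x ∈ periodicPts f) :
    ∃ μ : Measure X, IsProbabilityMeasure μ ∧ MeasurePreserving f μ μ ∧ μ {x} ≠ 0 ∧
      ∀ y, (∀ i : ℕ, f^[i] x ≠ y) → μ {y} = 0 := by
  obtain ⟨n, hn, hper⟩ := hx
  set ν : Measure X := ∑ i ∈ Finset.range n, Measure.dirac (f^[i] x) with hν
  have hn0 : (n : ENNReal) ≠ 0 := by exact_mod_cast hn.ne'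
  have hmap : ν.map f = ν := by
    have h1 : ν.map f = ∑ i ∈ Finset.range n, Measure.dirac (f^[i + 1] x) := by
      rw [hν, ← Measure.mapₗ_apply_of_measurable hf, map_sum]
      refine Finset.sum_congr rfl fun i _ => ?_
      rw [Measure.mapₗ_apply_of_measurable hf, Measure.map_dirac' hf, iterate_succ_apply']
    obtain ⟨m, rfl⟩ := Nat.exists_eq_succ_of_ne_zero hn.ne'
    -- The two sums differ only in the terms at `f^[m + 1] x` and at `x`, which agree by
    -- periodicity.
    rw [h1, hν, Finset.sum_range_succ, Finset.sum_range_succ']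
    congr 2
  refine ⟨(n : ENNReal)⁻¹ • ν, ⟨?_⟩, ⟨hf, ?_⟩, ?_, fun y hy => ?_⟩
  · simp [hν, ENNReal.inv_mul_cancel hn0]
  · rw [Measure.map_smul, hmap]
  · simp only [Measure.smul_apply, smul_eq_mul, hν, Measure.finsetSum_apply]
    refine mul_ne_zero (by simp) fun h0 => ?_
    have := Finset.sum_eq_zero_iff.1 h0 0 (Finset.mem_range.2 hn)
    simp at this
  · simp [hν, Set.indicator, hy]

namespace PeriodicExtension

variable {Y : Type*}

/-- The projection of `Y ∪ E` to `Y` that maps `q(k, j)` to `A^j (p k)`. -/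
def proj {A : Y → Y} {p : ℕ → Y} : PeriodicExtension A p → Y
  | base y => y
  | extra k j => A^[(j : ℕ)] (p k)

/-! ### Metric and topology of the extension -/

section Metric

variable [MetricSpace Y]

theorem dist_base_base {A : Y → Y} {p : ℕ → Y} (x y : Y) :
    dist (base x : PeriodicExtension A p) (base y) = dist x y := rfl

theorem dist_extra_base {A : Y → Y} {p : ℕ → Y} (k : ℕ) (j : Fin (minimalPeriod A (p k)))
    (y : Y) : dist (extra k j : PeriodicExtension A p) (base y) =
      1 / ((k : ℝ) + 1) + dist y (A^[(j : ℕ)] (p k)) := rfl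

theorem isometry_base {A : Y → Y} {p : ℕ → Y} :
    Isometry (base : Y → PeriodicExtension A p) :=
  Isometry.of_dist_eq dist_base_base

theorem dist_proj_le {A : Y → Y} {p : ℕ → Y} (x y : PeriodicExtension A p) :
    dist x.proj y.proj ≤ dist x y := by
  have hpos : ∀ k : ℕ, 0 < 1 / ((k : ℝ) + 1) := fun k => by positivity
  change _ ≤ extDist x y
  cases x with
  | base x =>
    cases y with
    | base y => exact le_rfl
    | extra m r => simp only [extDist, proj]; linarith [hpos m]
  | extra k j =>
    cases y with
    | base y => simp only [extDist, proj]; rw [dist_comm]; linarith [hpos k]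
    | extra m r =>
      by_cases h : k = m ∧ (j : ℕ) = (r : ℕ)
      · rw [extra_eq h]; simp [extDist]
      · simp only [extDist, if_neg h, proj]; linarith [hpos k, hpos m]

theorem isOpen_singleton_extra {A : Y → Y} {p : ℕ → Y} (k : ℕ)
    (j : Fin (minimalPeriod A (p k))) : IsOpen ({extra k j} : Set (PeriodicExtension A p)) := by
  have hpos : ∀ k : ℕ, 0 < 1 / ((k : ℝ) + 1) := fun k => by positivity
  rw [Metric.isOpen_singleton_iff]
  refine ⟨1 / ((k : ℝ) + 1), hpos k, fun y hy => ?_⟩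
  change extDist _ _ < _ at hy
  cases y with
  | base y =>
    simp only [extDist] at hy
    linarith [dist_nonneg (x := y) (y := A^[(j : ℕ)] (p k))]
  | extra m r =>
    by_cases h : m = k ∧ (r : ℕ) = (j : ℕ)
    · exact extra_eq h
    · simp only [extDist, if_neg h] at hy
      linarith [hpos m, dist_nonneg (x := A^[(r : ℕ)] (p m)) (y := A^[(j : ℕ)] (p k))]

/-- A finite subfamily covering the base also covers some `ε`-neighbourhood of it. Since `q(k, j)`
is at distance `1 / (k + 1)` from the base, only finitely many points are left over. -/
instance [CompactSpace Y] (A : Y → Y) (p : ℕ → Y) : CompactSpace (PeriodicExtension A p) := by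
  have hK : IsCompact (range (base : Y → PeriodicExtension A p)) :=
    isCompact_range isometry_base.continuous
  refine ⟨isCompact_of_finite_subcover fun {ι} U hU hcov => ?_⟩
  obtain ⟨t, ht⟩ := hK.elim_finite_subcover U hU ((subset_univ _).trans hcov)
  obtain ⟨ε, hε, hsub⟩ := hK.exists_thickening_subset_open
    (isOpen_biUnion fun i (_ : i ∈ t) => hU i) ht
  obtain ⟨n, hn⟩ := exists_nat_one_div_lt hε
  have hfin : (⋃ k ∈ Finset.range n, range (extra (A := A) (p := p) k)).Finite :=
    (Finset.range n).finite_toSet.biUnion fun k _ => finite_range _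
  obtain ⟨s, hs⟩ := hfin.isCompact.elim_finite_subcover U hU ((subset_univ _).trans hcov)
  classical
  refine ⟨t ∪ s, fun x _ => ?_⟩
  rw [Finset.set_biUnion_union]
  cases x with
  | base y => exact Or.inl (ht (mem_range_self y))
  | extra k j =>
    by_cases hk : k < n
    · refine Or.inr (hs ?_)
      simp only [mem_iUnion]
      exact ⟨k, Finset.mem_range.2 hk, mem_range_self j⟩
    · refine Or.inl (hsub (Metric.mem_thickening_iff.2 ⟨_, mem_range_self (A^[(j : ℕ)] (p k)), ?_⟩))
      rw [dist_extra_base, dist_self, add_zero]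
      refine lt_of_le_of_lt ?_ hn
      have : (n : ℝ) ≤ k := by exact_mod_cast not_lt.1 hk
      gcongr

end Metric

theorem compl_range_base {A : Y → Y} {p : ℕ → Y} :
    (range (base : Y → PeriodicExtension A p))ᶜ =
      range fun a : Σ k, Fin (minimalPeriod A (p k)) => extra a.1 a.2 := by
  ext x
  cases x <;> simp

theorem countable_compl_range_base {A : Y → Y} {p : ℕ → Y} :
    (range (base : Y → PeriodicExtension A p))ᶜ.Countable := by
  rw [compl_range_base]
  exact countable_range _

theorem infinite_compl_range_base {A : Y → Y} {p : ℕ → Y} (hp : ∀ k, p k ∈ periodicPts A) :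
    (range (base : Y → PeriodicExtension A p))ᶜ.Infinite := by
  refine infinite_of_injective_forall_mem
    (f := fun k => extra k ⟨0, minimalPeriod_pos_of_mem_periodicPts (hp k)⟩) (fun k m h => ?_)
    (fun k => by simp)
  injection h

/-! ### Dynamics of the extension -/

section Dynamics

variable [MetricSpace Y] {A : Y ≃ₜ Y} {p : ℕ → Y}

theorem semiconj_proj : Semiconj proj (extHomeo A p) A := by
  intro x
  cases x with
  | base y => rfl
  | extra k j =>
    change A^[((j : ℕ) + 1) % minimalPeriod A (p k)] (p k) = A (A^[(j : ℕ)] (p k))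
    rw [iterate_mod_minimalPeriod_eq, iterate_succ_apply']

theorem semiconj_proj_symm : Semiconj proj (extHomeo A p).symm A.symm := by
  intro x
  rw [Homeomorph.eq_symm_apply, ← semiconj_proj, Homeomorph.apply_symm_apply]

theorem semiconj_base : Semiconj base A (extHomeo A p) := fun _ => rfl

theorem semiconj_base_symm : Semiconj base A.symm (extHomeo A p).symm := fun _ => rfl

theorem extHomeo_iterate_extra (k : ℕ) (j : Fin (minimalPeriod A (p k))) (i : ℕ) :
    (extHomeo A p)^[i] (extra k j) =
      extra k ⟨((j : ℕ) + i) % minimalPeriod A (p k), Nat.mod_lt _ j.pos⟩ := by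
  induction i with
  | zero => exact extra_eq ⟨rfl, (Nat.mod_eq_of_lt j.2).symm⟩
  | succ i ih =>
    rw [iterate_succ_apply', ih]
    refine extra_eq ⟨rfl, ?_⟩
    simp only [Nat.mod_add_mod, Nat.add_assoc]

theorem exists_extHomeo_symm_iterate_extra (k : ℕ) (j : Fin (minimalPeriod A (p k))) (i : ℕ) :
    ∃ r, (extHomeo A p).symm^[i] (extra k j) = extra k r := by
  induction i with
  | zero => exact ⟨j, rfl⟩
  | succ i ih =>
    obtain ⟨r, hr⟩ := ih
    rw [iterate_succ_apply', hr]
    exact ⟨_, rfl⟩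

theorem minimalPeriod_extra (k : ℕ) (j : Fin (minimalPeriod A (p k))) :
    minimalPeriod (extHomeo A p) (extra k j) = minimalPeriod A (p k) := by
  refine Nat.dvd_antisymm (IsPeriodicPt.minimalPeriod_dvd ?_) ?_
  · rw [IsPeriodicPt, IsFixedPt, extHomeo_iterate_extra]
    exact extra_eq ⟨rfl, by simp [Nat.mod_eq_of_lt j.2]⟩
  · have h := isPeriodicPt_minimalPeriod (extHomeo A p) (extra k j)
    rw [IsPeriodicPt, IsFixedPt, extHomeo_iterate_extra] at h
    have h' : ((j : ℕ) + minimalPeriod (extHomeo A p) (extra k j)) % minimalPeriod A (p k) = j := by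
      injection h with _ h
      exact congrArg Fin.val h
    have h2 : (j : ℕ) + minimalPeriod (extHomeo A p) (extra k j) ≡ j + 0 [MOD minimalPeriod A (p k)] := by
      rw [Nat.ModEq, h', add_zero, Nat.mod_eq_of_lt j.2]
    exact (Nat.modEq_zero_iff_dvd).1 (Nat.ModEq.add_left_cancel' _ h2)

theorem range_iterate_extra (k : ℕ) (j : Fin (minimalPeriod A (p k))) :
    range (fun i : ℕ => (extHomeo A p)^[i] (extra k j)) =
      range (extra (A := A) (p := p) k) := by
  refine Subset.antisymm ?_ ?_
  · rintro _ ⟨i, rfl⟩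
    simp only [extHomeo_iterate_extra]
    exact mem_range_self _
  · rintro _ ⟨r, rfl⟩
    refine ⟨r + (minimalPeriod A (p k) - j), ?_⟩
    simp only [extHomeo_iterate_extra]
    refine extra_eq ⟨rfl, ?_⟩
    have hj := j.2
    change ((j : ℕ) + (r + (minimalPeriod A (p k) - j))) % minimalPeriod A (p k) = r
    rw [show (j : ℕ) + (r + (minimalPeriod A (p k) - j)) = r + minimalPeriod A (p k) by omega,
      Nat.add_mod_right, Nat.mod_eq_of_lt r.2]

/-- The orbits of `q(k, j)` and of its projection run in parallel, at constant distance `1 / (k +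
1)`. -/
theorem extra_mem_dynBall {δ : ℝ} {k : ℕ} (hk : 1 / ((k : ℝ) + 1) ≤ δ)
    (j : Fin (minimalPeriod A (p k))) :
    extra k j ∈ dynBall (extHomeo A p) δ (base (A^[(j : ℕ)] (p k))) := by
  have key : ∀ r : Fin (minimalPeriod A (p k)),
      dist (base (extra k r : PeriodicExtension A p).proj) (extra k r : PeriodicExtension A p)
        ≤ δ := by
    intro r
    rw [dist_comm, dist_extra_base]
    simpa [proj] using hk
  have hj : A^[(j : ℕ)] (p k) = (extra k j : PeriodicExtension A p).proj := rfl
  constructor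
  · intro i
    rw [hj, ← (semiconj_base.iterate_right i).eq, ← (semiconj_proj.iterate_right i).eq,
      extHomeo_iterate_extra]
    exact key _
  · intro i
    obtain ⟨r, hr⟩ := exists_extHomeo_symm_iterate_extra k j i
    rw [hj, ← (semiconj_base_symm.iterate_right i).eq, ← (semiconj_proj_symm.iterate_right i).eq,
      hr]
    exact key _

theorem eventually_extra_mem_dynBall {δ : ℝ} (hδ : 0 < δ) :
    ∀ᶠ k : ℕ in atTop, ∀ j : Fin (minimalPeriod A (p k)),
      extra k j ∈ dynBall (extHomeo A p) δ (base (A^[(j : ℕ)] (p k))) := by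
  filter_upwards [tendsto_one_div_add_atTop_nhds_zero_nat.eventually_lt_const hδ] with k hk j
  exact extra_mem_dynBall hk.le j

theorem extra_eq_of_proj_eq (hp : PeriodicInDistinctOrbits A p) {k m : ℕ}
    {j : Fin (minimalPeriod A (p k))} {r : Fin (minimalPeriod A (p m))}
    (h : (extra k j : PeriodicExtension A p).proj = (extra m r : PeriodicExtension A p).proj) :
    (extra k j : PeriodicExtension A p) = extra m r := by
  change A^[(j : ℕ)] (p k) = A^[(r : ℕ)] (p m) at h
  by_cases hkm : k = m
  · subst hkm
    refine extra_eq ⟨rfl, ?_⟩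
    exact (iterate_eq_iterate_iff_of_lt_minimalPeriod j.2 r.2).1 h
  -- Going forward through the rest of the period of `p m` leads from the common point `A^r (p m)`
  -- back to `p m`, so `p m` would be in the orbit of `p k`.
  · refine absurd ?_ (hp.2 k m hkm (minimalPeriod A (p m) - r + j))
    rw [iterate_add_apply, h, ← iterate_add_apply, Nat.sub_add_cancel r.2.le,
      iterate_minimalPeriod]

theorem encard_fiber_proj_le (hp : PeriodicInDistinctOrbits A p) (y : Y) :
    {x : PeriodicExtension A p | x.proj = y}.encard ≤ 2 := by
  by_cases h : ∃ k j, (extra k j : PeriodicExtension A p).proj = y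
  · obtain ⟨k, j, hkj⟩ := h
    refine (encard_le_encard (t := {base y, extra k j}) fun x hx => ?_).trans
      (encard_insert_le _ _ |>.trans (by rw [encard_singleton]; norm_num))
    cases x with
    | base x => exact Or.inl (congrArg base hx)
    | extra m r => exact Or.inr (extra_eq_of_proj_eq hp (hx.trans hkj.symm))
  · refine (encard_le_encard (t := {base y}) fun x hx => ?_).trans
      (by rw [encard_singleton]; norm_num)
    cases x with
    | base x => exact congrArg base hx
    | extra m r => exact absurd ⟨m, r, hx⟩ h

theorem nExpansive_two (hA : NExpansive 1 A) (hp : PeriodicInDistinctOrbits A p) :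
    NExpansive 2 (extHomeo A p) := by
  obtain ⟨δ, hδ, h⟩ := hA
  refine ⟨δ, hδ, fun x => (encard_le_encard fun z hz => ?_).trans (encard_fiber_proj_le hp x.proj)⟩
  -- Both `z.proj` and `x.proj` lie in the dynamical ball of `x.proj`, which has at most one
  -- element.
  refine encard_le_one_iff.1 (h x.proj) _ _ ⟨fun i => ?_, fun i => ?_⟩
    ⟨fun i => by simpa using hδ.le, fun i => by simpa using hδ.le⟩
  · rw [← (semiconj_proj.iterate_right i).eq, ← (semiconj_proj.iterate_right i).eq]
    exact (dist_proj_le _ _).trans (hz.1 i)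
  · rw [← (semiconj_proj_symm.iterate_right i).eq, ← (semiconj_proj_symm.iterate_right i).eq]
    exact (dist_proj_le _ _).trans (hz.2 i)

theorem not_stronglyMeasureExpansive (hp : ∀ k, p k ∈ periodicPts A) :
    ¬ StronglyMeasureExpansive (extHomeo A p) := by
  rintro ⟨δ, hδ, h⟩
  obtain ⟨k, hk⟩ := exists_nat_one_div_lt hδ
  have hk0 := minimalPeriod_pos_of_mem_periodicPts (hp k)
  obtain ⟨μ, hμ, hinv, hne, hzero⟩ := exists_invariant_measure_of_mem_periodicPts
    (f := extHomeo A p) (extHomeo A p).measurable (x := extra k ⟨0, hk0⟩)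
    (minimalPeriod_pos_iff_mem_periodicPts.1 (by rwa [minimalPeriod_extra]))
  have h0 := h μ hμ hinv (base (p k))
  rw [hzero (base (p k)) fun i => by rw [extHomeo_iterate_extra]; simp] at h0
  exact hne (measure_mono_null (singleton_subset_iff.2 (extra_mem_dynBall hk.le ⟨0, hk0⟩)) h0)

end Dynamics

end PeriodicExtension

/-! ### Bounded orbits of hyperbolic matrices -/

section Hyperbolic

/-- A bounded two-sided geometric sequence whose ratio is not of modulus `1` vanishes. -/
theorem eq_zero_of_bounded_of_geometric {w : ℤ → ℂ} {z : ℂ} {C : ℝ} (hz : ‖z‖ ≠ 1)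
    (hw : ∀ n, w (n + 1) = z * w n) (hC : ∀ n, ‖w n‖ ≤ C) (n : ℤ) : w n = 0 := by
  have hbdd : BddAbove (range fun n => ‖w n‖) := ⟨C, by rintro _ ⟨n, rfl⟩; exact hC n⟩
  -- Shifting the index does not change this supremum but multiplies the norms by `‖z‖ ≠ 1`, which
  -- forces it to be zero.
  set s := ⨆ n, ‖w n‖ with hs
  have hle : ∀ n, ‖w n‖ ≤ s := fun n => le_ciSup hbdd n
  have hnorm : ∀ n, ‖w (n + 1)‖ = ‖z‖ * ‖w n‖ := fun n => by rw [hw, norm_mul]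
  have hs0 : s ≤ 0 := by
    rcases lt_or_gt_of_ne hz with h | h
    · have : s ≤ ‖z‖ * s := ciSup_le fun n => by
        have := hnorm (n - 1)
        rw [sub_add_cancel] at this
        rw [this]
        exact mul_le_mul_of_nonneg_left (hle _) (norm_nonneg _)
      nlinarith
    · have : s ≤ s / ‖z‖ := ciSup_le fun n => by
        rw [le_div_iff₀ (by linarith), mul_comm, ← hnorm]
        exact hle _
      rw [le_div_iff₀ (by linarith)] at this
      nlinarith
  exact norm_le_zero_iff.1 ((hle n).trans hs0)

theorem mem_spectrum_of_quadratic {N : Matrix (Fin 2) (Fin 2) ℂ} {z : ℂ}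
    (h : z ^ 2 - (N 0 0 + N 1 1) * z + (N 0 0 * N 1 1 - N 0 1 * N 1 0) = 0) :
    z ∈ spectrum ℂ N := by
  rw [spectrum.mem_iff, Matrix.isUnit_iff_isUnit_det, Matrix.det_fin_two]
  simp only [Matrix.sub_apply, Matrix.algebraMap_matrix_apply, Algebra.algebraMap_self,
    RingHom.id_apply, if_true, zero_ne_one, one_ne_zero, if_false, isUnit_iff_ne_zero, not_not]
  linear_combination h

/-- A bounded two-sided orbit of a hyperbolic matrix vanishes. -/
theorem IsHyperbolicMatrix.eq_zero_of_bounded {M : GL (Fin 2) ℤ} (hM : IsHyperbolicMatrix M)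
    {v : ℤ → Fin 2 → ℝ} {C : ℝ} (hv : ∀ n i, v (n + 1) i = ∑ j, (M.val i j : ℝ) * v n j)
    (hC : ∀ n i, |v n i| ≤ C) (n : ℤ) (i : Fin 2) : v n i = 0 := by
  set t : ℂ := M.val 0 0 + M.val 1 1
  set d : ℂ := M.val 0 0 * M.val 1 1 - M.val 0 1 * M.val 1 0
  -- A square root of the discriminant, so that the eigenvalues are `(t ± s) / 2`.
  obtain ⟨s, hs⟩ := IsAlgClosed.exists_pow_nat_eq (t ^ 2 - 4 * d) (n := 2) two_pos
  have hroot : ∀ z : ℂ, z ^ 2 - t * z + d = 0 → ‖z‖ ≠ 1 := fun z hz =>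
    hM z (mem_spectrum_of_quadratic (by simpa [t, d] using hz))
  have h1 := hroot ((t + s) / 2) (by linear_combination hs / 4)
  have h2 := hroot ((t - s) / 2) (by linear_combination hs / 4)
  have hv' : ∀ n i, (v (n + 1) i : ℂ) = M.val i 0 * v n 0 + M.val i 1 * v n 1 := fun n i => by
    rw [hv, Fin.sum_univ_two]; push_cast; rfl
  -- Cayley–Hamilton, with trace `t` and determinant `d`.
  have hrec : ∀ n i, (v (n + 1 + 1) i : ℂ) = t * v (n + 1) i - d * v n i := fun n i => by
    rw [hv' (n + 1), hv' n, hv' n]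
    fin_cases i <;> simp [hv' n, t, d] <;> ring
  have hbd : ∀ n i, ‖(v n i : ℂ)‖ ≤ C := fun n i => by
    rw [Complex.norm_real]; exact hC n i
  -- Factoring the recurrence: `v (n + 1) - (t - s) / 2 * v n` is geometric with ratio `(t + s) /
  -- 2`, hence zero. Then `v` itself is geometric with the other ratio. No diagonalization is
  -- needed.
  have hgeom : ∀ n i, (v (n + 1) i : ℂ) = (t - s) / 2 * v n i := fun n i => by
    refine sub_eq_zero.1 (eq_zero_of_bounded_of_geometric
      (w := fun n => (v (n + 1) i : ℂ) - (t - s) / 2 * v n i) (C := C + ‖(t - s) / 2‖ * C) h1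
      (fun n => ?_) (fun n => ?_) n)
    · simp only [hrec]
      linear_combination -(v n i : ℂ) * hs / 4
    · refine (norm_sub_le _ _).trans (add_le_add (hbd _ _) ?_)
      rw [norm_mul]
      exact mul_le_mul_of_nonneg_left (hbd _ _) (norm_nonneg _)
  exact_mod_cast eq_zero_of_bounded_of_geometric (w := fun n => (v n i : ℂ)) h2
    (fun n => hgeom n i) (fun n => hbd n i) n

end Hyperbolic

/-! ### Expansiveness of hyperbolic toral automorphisms -/

section Torus

theorem UnitAddCircle.exists_lift_abs_eq_norm (z : UnitAddCircle) :
    ∃ a : ℝ, (a : UnitAddCircle) = z ∧ |a| = ‖z‖ := by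
  induction z using QuotientAddGroup.induction_on with
  | H a =>
    refine ⟨a - round a, ?_, (UnitAddCircle.norm_eq (x := a)).symm⟩
    have : ((round a : ℝ) : UnitAddCircle) = 0 :=
      (AddCircle.coe_eq_zero_iff 1).2 ⟨round a, by simp⟩
    rw [AddCircle.coe_sub, this, sub_zero]

theorem UnitAddCircle.eq_zero_of_abs_lt_one {a : ℝ} (h : (a : UnitAddCircle) = 0)
    (ha : |a| < 1) : a = 0 := by
  obtain ⟨n, hn⟩ := (AddCircle.coe_eq_zero_iff 1).1 h
  have hn' : (n : ℝ) = a := by simpa using hn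
  rw [← hn'] at ha ⊢
  have : |n| < 1 := by exact_mod_cast ha
  exact_mod_cast Int.abs_lt_one_iff.1 this

/-- A small two-sided orbit of a hyperbolic automorphism of the torus is the orbit of `0`. -/
theorem IsHyperbolicMatrix.exists_pos_eq_zero {M : GL (Fin 2) ℤ} (hM : IsHyperbolicMatrix M) :
    ∃ δ : ℝ, 0 < δ ∧ ∀ z : ℤ → Fin 2 → UnitAddCircle,
      (∀ n i, z (n + 1) i = ∑ j, M.val i j • z n j) → (∀ n i, ‖z n i‖ ≤ δ) →
      ∀ n i, z n i = 0 := by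
  -- With lifts bounded by `1 / (2 * K)`, the error `v (n + 1) - M v n` has entries of size at most
  -- `1 / 2`. They are integers, so the lifts form an exact orbit of the matrix.
  set K : ℝ := 1 + ∑ i, ∑ j, |(M.val i j : ℝ)|
  have hK : ∀ i, 1 + ∑ j, |(M.val i j : ℝ)| ≤ K := fun i => by
    have := Finset.single_le_sum (f := fun i => ∑ j, |(M.val i j : ℝ)|)
      (fun i _ => by positivity) (Finset.mem_univ i)
    simp only [K]
    linarith
  have hK0 : 0 < K := by positivity
  refine ⟨1 / (2 * K), by positivity, fun z hz hδ => ?_⟩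
  choose v hv hvn using fun n i => UnitAddCircle.exists_lift_abs_eq_norm (z n i)
  have hvδ : ∀ n i, |v n i| ≤ 1 / (2 * K) := fun n i => (hvn n i).trans_le (hδ n i)
  have hrec : ∀ n i, v (n + 1) i = ∑ j, (M.val i j : ℝ) * v n j := fun n i => by
    refine sub_eq_zero.1 (UnitAddCircle.eq_zero_of_abs_lt_one ?_ ?_)
    · have hsum : ((∑ j, (M.val i j : ℝ) * v n j : ℝ) : UnitAddCircle) = z (n + 1) i := by
        rw [hz]
        simp only [← hv, Fin.sum_univ_two, AddCircle.coe_add, ← AddCircle.coe_zsmul,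
          zsmul_eq_mul]
      rw [AddCircle.coe_sub, hv, hsum, sub_self]
    · have hle : |∑ j, (M.val i j : ℝ) * v n j| ≤ (∑ j, |(M.val i j : ℝ)|) * (1 / (2 * K)) := by
        refine (Finset.abs_sum_le_sum_abs _ _).trans ?_
        rw [Finset.sum_mul]
        refine Finset.sum_le_sum fun j _ => ?_
        rw [abs_mul]
        exact mul_le_mul_of_nonneg_left (hvδ n j) (abs_nonneg _)
      have hhalf : (1 + ∑ j, |(M.val i j : ℝ)|) * (1 / (2 * K)) ≤ 1 / 2 := by
        refine (mul_le_mul_of_nonneg_right (hK i) (by positivity)).trans_eq ?_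
        field_simp
      linarith [abs_sub (v (n + 1) i) (∑ j, (M.val i j : ℝ) * v n j), hvδ (n + 1) i]
  intro n i
  rw [← hv, hM.eq_zero_of_bounded hrec hvδ, AddCircle.coe_zero]

theorem toralMap_sub (M : Matrix (Fin 2) (Fin 2) ℤ) (x y : FlatTorus) :
    toralMap M (x - y) = toralMap M x - toralMap M y := by
  ext i
  simp [toralMap, smul_sub]

/-- The homomorphism of the torus induced by an integer matrix. -/
def toralHom (M : Matrix (Fin 2) (Fin 2) ℤ) : FlatTorus →+ FlatTorus :=
  AddMonoidHom.ofMapSub (toralMap M) (toralMap_sub M)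

/-- Linear Anosov diffeomorphisms of the torus are expansive. -/
theorem IsHyperbolicMatrix.nExpansive_one {M : GL (Fin 2) ℤ} (hM : IsHyperbolicMatrix M) :
    NExpansive 1 (toralAut M) := by
  obtain ⟨δ, hδ, h⟩ := hM.exists_pos_eq_zero
  have key : ∀ x y, y ∈ dynBall (toralAut M) δ x → x = y := fun x y hy => by
    -- Integer powers of a permutation join the forward and backward orbits into one sequence over
    -- `ℤ`.
    set e : Equiv.Perm FlatTorus := (toralAut M).toEquiv
    have hdist : ∀ n : ℤ, dist ((e ^ n) x) ((e ^ n) y) ≤ δ := fun n => by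
      obtain ⟨k, rfl | rfl⟩ := n.eq_nat_or_neg
      · rw [zpow_natCast, ← Equiv.Perm.iterate_eq_pow]
        exact hy.1 k
      · rw [zpow_neg, zpow_natCast, ← inv_pow, ← Equiv.Perm.iterate_eq_pow]
        exact hy.2 k
    have hz := h (fun n i => ((e ^ n) x - (e ^ n) y) i) (fun n i => ?_) (fun n i => ?_) 0
    · ext i
      exact sub_eq_zero.1 (hz i)
    · have he : ∀ w, (e ^ (n + 1)) w = toralMap M.val ((e ^ n) w) := fun w => by
        rw [add_comm, zpow_one_add]
        rfl
      simp only [he, ← toralMap_sub]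
      rfl
    · refine (PiLp.norm_apply_le _ i).trans ?_
      rw [← dist_eq_norm]
      exact hdist n
  refine ⟨δ, hδ, fun x => ?_⟩
  rw [Nat.cast_one, encard_le_one_iff]
  exact fun a b ha hb => (key x a ha).symm.trans (key x b hb)

instance : CompactSpace FlatTorus :=
  (PiLp.homeomorph 2 (fun _ : Fin 2 => UnitAddCircle)).symm.compactSpace

/-! ### Torsion points as periodic points -/

theorem finite_torsion_flatTorus {n : ℕ} (hn : 0 < n) : {x : FlatTorus | n • x = 0}.Finite := by
  refine Set.Finite.subset (Set.Finite.preimage (WithLp.ofLp_injective 2).injOn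
    (Set.Finite.pi fun _ : Fin 2 => AddCircle.finite_torsion (1 : ℝ) hn)) fun x hx => ?_
  intro i _
  exact congrArg (fun y : FlatTorus => y i) hx

/-- The orbit stays in a finite torsion subgroup, so it repeats; injectivity turns the repetition
into a return to `x`. -/
theorem toralAut_mem_periodicPts (M : GL (Fin 2) ℤ) {x : FlatTorus} (hx : IsOfFinAddOrder x) :
    x ∈ periodicPts (toralAut M) := by
  have hfin := finite_torsion_flatTorus hx.addOrderOf_pos
  have hmem : ∀ i : ℕ, addOrderOf x • (toralAut M)^[i] x = 0 := fun i => by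
    induction i with
    | zero => exact addOrderOf_nsmul_eq_zero x
    | succ i ih =>
      rw [iterate_succ_apply']
      change addOrderOf x • toralHom M.val ((toralAut M)^[i] x) = 0
      rw [← map_nsmul, ih, map_zero]
  obtain ⟨i, j, hij, heq⟩ := hfin.exists_lt_map_eq_of_forall_mem
    (f := fun i : ℕ => (toralAut M)^[i] x) hmem
  refine ⟨j - i, Nat.sub_pos_of_lt hij, ((toralAut M).injective.iterate i) ?_⟩
  rw [← iterate_add_apply, Nat.add_sub_cancel' hij.le]
  exact heq.symm

/-- The additive order is an orbit invariant, used to separate orbits. -/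
theorem addOrderOf_toralAut_iterate (M : GL (Fin 2) ℤ) (x : FlatTorus) (i : ℕ) :
    addOrderOf ((toralAut M)^[i] x) = addOrderOf x := by
  induction i with
  | zero => rfl
  | succ i ih =>
    rw [iterate_succ_apply', ← ih]
    exact addOrderOf_injective (toralHom M.val) (toralAut M).injective _

theorem exists_addOrderOf_eq {n : ℕ} (hn : 0 < n) : ∃ x : FlatTorus, addOrderOf x = n := by
  -- The diagonal point `(1/n, 1/n)`.
  refine ⟨WithLp.toLp 2 fun _ => (((1 : ℝ) / n : ℝ) : UnitAddCircle), ?_⟩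
  refine (addOrderOf_injective (AddMonoidHom.mk' (fun a : UnitAddCircle =>
    (WithLp.toLp 2 fun _ => a : FlatTorus)) fun a b => rfl) (fun a b h => ?_) _).trans
    (AddCircle.addOrderOf_period_div hn)
  exact congrArg (fun y : FlatTorus => y 0) h

theorem exists_periodicInDistinctOrbits (M : GL (Fin 2) ℤ) :
    ∃ p : ℕ → FlatTorus, PeriodicInDistinctOrbits (toralAut M) p := by
  choose p hp using fun k : ℕ => exists_addOrderOf_eq k.succ_pos
  refine ⟨p, fun k => toralAut_mem_periodicPts M (addOrderOf_pos_iff.1 ?_), fun k m hkm i h => ?_⟩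
  · rw [hp]
    exact k.succ_pos
  · have := addOrderOf_toralAut_iterate M (p k) i
    rw [h, hp, hp] at this
    omega

/-- The matrix of Arnold's cat map. -/
def catMatrix : GL (Fin 2) ℤ where
  val := !![2, 1; 1, 1]
  inv := !![1, -1; -1, 2]
  val_inv := by decide
  inv_val := by decide

theorem isHyperbolicMatrix_catMatrix : IsHyperbolicMatrix catMatrix := by
  intro z hz h1
  rw [spectrum.mem_iff, Matrix.isUnit_iff_isUnit_det, Matrix.det_fin_two] at hz
  simp [catMatrix, Matrix.algebraMap_matrix_apply] at hz
  -- On the unit circle the right side has modulus `3` and the left side at most `2`.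
  have h2 : z ^ 2 + 1 = 3 * z := by linear_combination hz
  have h3 := norm_add_le (z ^ 2) 1
  rw [h2] at h3
  norm_num [h1] at h3

end Torus

theorem mainTheorem11 :
    -- the construction, for every linear Anosov diffeomorphism `A` of the torus
    (∀ M : GL (Fin 2) ℤ, IsHyperbolicMatrix M →
      (∃ p : ℕ → FlatTorus, PeriodicInDistinctOrbits (toralAut M) p) ∧
      ∀ p : ℕ → FlatTorus, PeriodicInDistinctOrbits (toralAut M) p →
        -- `X` is compact
        CompactSpace (PeriodicExtension (toralAut M) p) ∧
        -- `f` on `X` extends `A` on the isometrically embedded torus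
        Isometry (PeriodicExtension.base : FlatTorus → PeriodicExtension (toralAut M) p) ∧
        (∀ y : FlatTorus, PeriodicExtension.extHomeo (toralAut M) p (PeriodicExtension.base y) =
          PeriodicExtension.base (toralAut M y)) ∧
        -- `E` is countably infinite and consists of isolated points
        (Set.range (PeriodicExtension.base :
          FlatTorus → PeriodicExtension (toralAut M) p))ᶜ.Infinite ∧
        (Set.range (PeriodicExtension.base :
          FlatTorus → PeriodicExtension (toralAut M) p))ᶜ.Countable ∧
        (∀ (k : ℕ) (j : Fin (Function.minimalPeriod (toralAut M) (p k))),
          IsOpen ({PeriodicExtension.extra k j} : Set (PeriodicExtension (toralAut M) p))) ∧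
        -- for each `k` the points `q(k, j)` form one periodic orbit, with the period of `p k`
        (∀ (k : ℕ) (j : Fin (Function.minimalPeriod (toralAut M) (p k))),
          Function.minimalPeriod (PeriodicExtension.extHomeo (toralAut M) p)
              (PeriodicExtension.extra k j) = Function.minimalPeriod (toralAut M) (p k) ∧
          Set.range (fun i : ℕ => (PeriodicExtension.extHomeo (toralAut M) p)^[i]
              (PeriodicExtension.extra k j)) =
            Set.range (PeriodicExtension.extra (A := toralAut M) (p := p) k)) ∧
        -- the new periodic orbits accumulate on periodic orbits of `A`
        (∀ δ : ℝ, 0 < δ → ∀ᶠ k : ℕ in Filter.atTop,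
          ∀ j : Fin (Function.minimalPeriod (toralAut M) (p k)),
            PeriodicExtension.extra k j ∈ dynBall (PeriodicExtension.extHomeo (toralAut M) p) δ
              (PeriodicExtension.base ((toralAut M)^[(j : ℕ)] (p k)))) ∧
        -- the expansiveness properties
        NExpansive 2 (PeriodicExtension.extHomeo (toralAut M) p) ∧
        MeasureExpansive (PeriodicExtension.extHomeo (toralAut M) p) ∧
        ¬ StronglyMeasureExpansive (PeriodicExtension.extHomeo (toralAut M) p)) ∧
    -- hence `N`-expansiveness does not imply strong measure expansiveness
    (∀ N : ℕ, 2 ≤ N →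
      ∃ (X : Type) (_ : MetricSpace X) (_ : CompactSpace X) (_ : MeasurableSpace X)
        (_ : BorelSpace X) (f : X ≃ₜ X),
        NExpansive N f ∧ MeasureExpansive f ∧ ¬ StronglyMeasureExpansive f) := by
  have main : ∀ (M : GL (Fin 2) ℤ), IsHyperbolicMatrix M → ∀ p : ℕ → FlatTorus,
      PeriodicInDistinctOrbits (toralAut M) p →
      NExpansive 2 (PeriodicExtension.extHomeo (toralAut M) p) ∧
      MeasureExpansive (PeriodicExtension.extHomeo (toralAut M) p) ∧
      ¬ StronglyMeasureExpansive (PeriodicExtension.extHomeo (toralAut M) p) :=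
    fun M hM p hp =>
      have h := PeriodicExtension.nExpansive_two hM.nExpansive_one hp
      ⟨h, h.measureExpansive, PeriodicExtension.not_stronglyMeasureExpansive hp.1⟩
  refine ⟨fun M hM => ⟨exists_periodicInDistinctOrbits M, fun p hp =>
    ⟨inferInstance, PeriodicExtension.isometry_base, fun _ => rfl,
      PeriodicExtension.infinite_compl_range_base hp.1,
      PeriodicExtension.countable_compl_range_base, PeriodicExtension.isOpen_singleton_extra,
      fun k j => ⟨PeriodicExtension.minimalPeriod_extra k j,
        PeriodicExtension.range_iterate_extra k j⟩,
      fun δ hδ => PeriodicExtension.eventually_extra_mem_dynBall hδ, main M hM p hp⟩⟩,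
    fun N hN => ?_⟩
  obtain ⟨p, hp⟩ := exists_periodicInDistinctOrbits catMatrix
  obtain ⟨h1, h2, h3⟩ := main catMatrix isHyperbolicMatrix_catMatrix p hp
  exact ⟨PeriodicExtension (toralAut catMatrix) p, inferInstance, inferInstance, inferInstance,
    inferInstance, PeriodicExtension.extHomeo (toralAut catMatrix) p, h1.mono hN, h2, h3⟩
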